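/- Let $G=(\mathcal V,\mathcal E)$ be a finite directed acyclic multigraph, and let $\mathcal N=(G,S,\gamma)$ be a network with $s\ge 1$ distinct source nodes $S=\{\sigma_1,\dots,\sigma_s\}\subseteq\mathcal V$ and a sink $\gamma\in\mathcal V\setminus S$, such that no source has an incoming edge and every node other than $\gamma$ has a directed path to $\gamma$. For $C\subseteq\mathcal E$ let $I_C\subseteq S$ be the set of sources that have no path to $\gamma$ after the edges in $C$ are deleted, and let $\Lambda(\mathcal N)=\{C\subseteq\mathcal E : I_C\neq\varnothing\}$ be the set of cuts. Let $\mathbb F_q$ be the finite field with $q$ elements. In a $(k,n)$ network code over $\mathbb F_q$ ($k,n\ge 1$), each source $\sigma_i$ generates a vector in $\mathbb F_q^k$. Each edge $e$ carries a vector in $\mathbb F_q^n$, namely a function (fixed by the code) of the vector generated at the tail of $e$, if that tail is a source, or of the vectors received on the incoming edges of the tail otherwise, plus an error vector $z_e\in\mathbb F_q^n$. The sink decodes from the vectors it receives on its incoming edges. The code computes $f:\mathbb F_q^s\to\mathcal O$ against $\tau$ errors if, for all source vectors $(x_{i1},\dots,x_{ik})$, $1\le i\le s$, and all errors $(z_e)_{e\in\mathcal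 E}$ with $z_e\ne 0$ for at most $\tau$ edges $e$, the sink outputs the $k$ values $f(x_{1j},\dots,x_{sj})$, $1\le j\le k$. The robust computing capacity is $$C(\mathcal N,f,\tau)=\sup\{k/n : \text{some } (k,n) \text{ network code over } \mathbb F_q \text{ computes } f \text{ against } \tau \text{ errors}\},$$ the supremum of the empty set being $0$. Write $C(\mathcal N,T,\tau)$ for $f(\mathbf x)=\mathbf x\cdot T$, where $T$ is a matrix with $s$ rows; $\mathbf 1$ is the all-one $s\times 1$ matrix (the sum function) and $I$ is the $s\times s$ identity matrix. Theorem. Let $\tau\ge 1$ be an integer with $2\tau<\min_{C\in\Lambda(\mathcal N)}|C|$. Then there is $q_0$, depending only on $\mathcal N$ and $\tau$, such that for every prime power $q\ge q_0$, $$C(\mathcal N,\mathbf 1,\tau)=\min_{C\in\Lambda(\mathcal N)}(|C|-2\tau)$$ (that is, $C(\mathcal N,\mathbf 1,\tau)\ge\min_{C\in\Lambda(\mathcal N)}(|C|-2\tau)$, matching the cut-set upper bound), and $$C(\mathcal N,I,\tau)\ge\min_{C\in\Lambda(\mathcal N)}\left\lfloor\frac{|C|-2\tau}{|I_C|}\right\rfloor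 .$$ -/

import Mathlib

open scoped ENNReal Matrix

/-- A directed multigraph on the vertex type `V` with edge type `E`: parallel edges are allowed. -/
structure DiMultigraph (V E : Type*) where
  tail : E → V
  head : E → V

/-- `G.Reaches C u v`: there is a (nonempty) directed path
from `u` to `v` none of whose edges lies in `C`. -/
def DiMultigraph.Reaches {V E : Type*} (G : DiMultigraph V E) (C : Finset E) (u v : V) : Prop :=
  Relation.TransGen (fun a b => ∃ e, e ∉ C ∧ G.tail e = a ∧ G.head e = b) u v

/-- A network `(G, S, γ)` with source nodes `S = {σ_1, …, σ_s}` (listed without repetition) and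
sink `γ ∉ S` over a directed acyclic multigraph `G`. Sources have no incoming edges, and
every node other than the sink has a directed path to the sink. -/
structure Network (V E : Type*) (s : ℕ) extends DiMultigraph V E where
  source : Fin s ↪ V
  sink : V
  acyclic : ∀ v, ¬ toDiMultigraph.Reaches ∅ v v
  source_ne_sink : ∀ i, source i ≠ sink
  head_ne_source : ∀ e i, head e ≠ source i
  reaches_sink : ∀ u, u ≠ sink → toDiMultigraph.Reaches ∅ u sink

namespace Network

/-- `I_C`: the (indices of) sources without a path to the sink once the edges in `C` are deleted. -/
def separated {V E : Type*} {s : ℕ} (N : Network V E s) (C : Finset E) : Set (Fin s) :=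
  {i | ¬ N.Reaches C (N.source i) N.sink}

/-- `Λ(N)`: the edge sets that meet every path from some source to the sink. -/
def cuts {V E : Type*} {s : ℕ} (N : Network V E s) : Set (Finset E) :=
  {C | ∃ i, ¬ N.Reaches C (N.source i) N.sink}

end Network

/-- A `(k, n)` network code over the alphabet `A` for computing functions with values in `O`.
Source `i` generates a vector in `A ^ k`, and every edge carries a vector in `A ^ n`. The message
sent on `e` is a function of the vector generated at the tail of `e` (if that is a source) and of
the messages on the incoming edges of the tail of `e`. The sink decodes `k` function values from
the messages on its incoming edges. -/
structure NetworkCode {V E : Type*} {s : ℕ} (N : Network V E s) (A O : Type*) (k n : ℕ) where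
  enc : ∀ e : E, ({i : Fin s // N.source i = N.tail e} → Fin k → A) →
    ({d : E // N.head d = N.tail e} → Fin n → A) → Fin n → A
  dec : ({e : E // N.head e = N.sink} → Fin n → A) → Fin k → O

namespace NetworkCode

/-- `u` is the family of messages actually carried by the edges when the sources generate `x` and
the error message `z e` is added on each edge `e`. -/
def IsTransmission {V E A O : Type*} {s k n : ℕ} {N : Network V E s} [Add A]
    (c : NetworkCode N A O k n) (x : Fin s → Fin k → A) (z u : E → Fin n → A) : Prop :=
  ∀ e, u e = c.enc e (fun i => x i) (fun d => u d) + z e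

/-- By acyclicity, the source messages and the errors determine the transmitted messages. -/
theorem existsUnique_isTransmission {V E A O : Type*} {s k n : ℕ} {N : Network V E s} [Add A]
    [Finite E] (c : NetworkCode N A O k n) (x : Fin s → Fin k → A) (z : E → Fin n → A) :
    ∃! u, c.IsTransmission x z u := by
  have key : ∀ d e, Relation.TransGen (fun d e => N.head d = N.tail e) d e →
      N.Reaches ∅ (N.tail d) (N.tail e) := by
    intro d e h
    induction h with
    | single h => exact .single ⟨d, by simp, rfl, h⟩
    | @tail b _ _ h ih => exact ih.tail ⟨b, by simp, rfl, h⟩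
  have : Std.Irrefl (Relation.TransGen fun d e => N.head d = N.tail e) :=
    ⟨fun e h => N.acyclic _ (key e e h)⟩
  have wf' := Finite.wellFounded_of_trans_of_irrefl
    (Relation.TransGen fun d e => N.head d = N.tail e)
  have wf : WellFounded fun d e => N.head d = N.tail e :=
    Subrelation.wf (r := Relation.TransGen fun d e => N.head d = N.tail e)
      (fun h => Relation.TransGen.single h) wf'
  refine ⟨wf.fix fun e ih => c.enc e (fun i => x i) (fun d => ih d.1 d.2) + z e, ?_, ?_⟩
  · intro e
    exact wf.fix_eq _ e
  · intro u hu
    funext e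
    induction e using wf.induction with
    | _ e ih =>
      rw [hu e, wf.fix_eq]
      congr 2
      funext d
      exact ih d.1 d.2

/-- `c` computes the target function `f` (`k` times) against `τ` errors: whatever the source
messages `x`, the error pattern `ρ` of at most `τ` edges, and the error vector `z` matching `ρ`,
the sink outputs the `k` values of `f`. -/
def Computes {V E A O : Type*} {s k n : ℕ} {N : Network V E s} [AddZeroClass A]
    (c : NetworkCode N A O k n) (f : (Fin s → A) → O) (τ : ℕ) : Prop :=
  ∀ (x : Fin s → Fin k → A) (ρ : Finset E) (z u : E → Fin n → A),
    ρ.card ≤ τ → (∀ e, e ∉ ρ → z e = 0) → c.IsTransmission x z u →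
      c.dec (fun e => u e) = fun j => f (fun i => x i j)

end NetworkCode

/-- The robust computing capacity `C(N, f, τ)`: the supremum of the rates `k / n` of the `(k, n)`
network codes, `k, n ≥ 1`, over the alphabet of `f` that compute `f` against `τ` errors. -/
noncomputable def robustCapacity {V E A O : Type*} {s : ℕ} [AddZeroClass A] (N : Network V E s)
    (f : (Fin s → A) → O) (τ : ℕ) : ℝ≥0∞ :=
  sSup {r | ∃ k n : ℕ, 0 < k ∧ 0 < n ∧ (∃ c : NetworkCode N A O k n, c.Computes f τ) ∧
    r = (k : ℝ≥0∞) / n}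

/-- The linear target function `x ↦ x · T`. -/
def linearTarget {F : Type*} [Field F] {s l : ℕ} (T : Matrix (Fin s) (Fin l) F) :
    (Fin s → F) → (Fin l → F) :=
  fun x => x ᵥ* T

/-!
Every edge `e` is given a vector `K e`, and the `j`-th message of source `i` a vector `g i j`, such
that the sink learns `∑ x i j • g i j` up to an element of the span of the `K e` of the corrupted
edges `e`. This only requires each vector to be a combination of the vectors of the edges that
follow. Choose these combinations generically, from the sink backwards. If the sink could confuse
two inputs, a nontrivial combination of the `g i j` would lie in the span of the `K e` of at most
`2 * τ` edges, and the vectors involved would span a proper subspace `U`. The edges leaving the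
region of nodes all of whose vectors lie in `U` then form a cut, and by genericity their vectors are
linearly independent in `U`, so that this cut is too small.

Conversely, split a cut `C`, along a topological order of the edges, into three consecutive pieces
of which the last two have at most `τ` edges. Two inputs that produce the same messages on the first
piece can be confused by errors on the second or on the third piece, so the messages on
`|C| - 2 * τ` edges determine the inputs.
-/

theorem exists_linearOrder_lt_of_irrefl_transGen {α : Type*} {r : α → α → Prop}
    (hr : ∀ a, ¬ Relation.TransGen r a a) : ∃ _ : LinearOrder α, ∀ a b, r a b → a < b := by
  have : IsStrictOrder α (Relation.TransGen r) := { irrefl := hr, trans := fun _ _ _ => .trans }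
  let _ : PartialOrder α := partialOrderOfSO (Relation.TransGen r)
  exact ⟨(inferInstance : LinearOrder (LinearExtension α)), fun a b hab =>
    toLinearExtension.monotone.strictMono_of_injective Function.injective_id
      (show a < b from .single hab)⟩

theorem exists_subset_card_eq_forall_lt {α : Type*} [LinearOrder α] (C : Finset α) {m : ℕ}
    (hm : m ≤ C.card) : ∃ T ⊆ C, T.card = m ∧ ∀ a ∈ T, ∀ b ∈ C \ T, a < b := by
  induction m with
  | zero => exact ⟨∅, by simp, rfl, by simp⟩
  | succ m ih =>
    obtain ⟨T, hTC, rfl, hT⟩ := ih (by omega)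
    obtain ⟨a, ha, hmin⟩ := (C \ T).exists_min_image id (by
      rw [Finset.sdiff_nonempty]
      exact fun hCT => (Finset.card_le_card hCT).not_gt hm)
    obtain ⟨haC, haT⟩ := Finset.mem_sdiff.1 ha
    refine ⟨insert a T, Finset.insert_subset haC hTC, Finset.card_insert_of_notMem haT, ?_⟩
    intro c hc b hb
    rw [Finset.mem_sdiff, Finset.mem_insert, not_or] at hb
    have hbT : b ∈ C \ T := Finset.mem_sdiff.2 ⟨hb.1, hb.2.2⟩
    rcases Finset.mem_insert.1 hc with rfl | hcT
    · exact (hmin b hbT).lt_of_ne' hb.2.1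
    · exact hT c hcT b hbT

theorem exists_forall_rel_of_eqOn_Iio {D M : Type*} [Preorder D] [WellFoundedLT D] [Nonempty M]
    {R : D → (D → M) → M → Prop} (hR : ∀ d K, ∃ x, R d K x)
    (hcongr : ∀ d K K' x, Set.EqOn K K' (Set.Iio d) → R d K x → R d K' x) :
    ∃ K : D → M, ∀ d, R d K (K d) := by
  classical
  inhabit M
  choose f hf using hR
  let extend (d : D) (K : ∀ a, a < d → M) (a : D) : M := if h : a < d then K a h else default
  let K : D → M := wellFounded_lt.fix fun d K => f d (extend d K)
  have hK (d : D) : K d = f d (extend d fun a _ => K a) := wellFounded_lt.fix_eq _ d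
  refine ⟨K, fun d => ?_⟩
  rw [hK]
  exact hcongr d _ _ _ (fun a ha => dif_pos ha) (hf d _)

section GenericFamily

variable {F M D : Type*} [Field F] [AddCommGroup M] [Module F M]

theorem exists_mem_forall_mem_imp_le {ι : Type*} [Finite ι] (W : Submodule F M)
    (p : ι → Submodule F M) (hF : (Nat.card ι : ℕ∞) < ENat.card F) :
    ∃ x ∈ W, ∀ i, x ∈ p i → W ≤ p i := by
  classical
  have := Fintype.ofFinite ι
  let q (i : {i // ¬ W ≤ p i}) : Submodule F W := (p i).comap W.subtype
  have hq (i) : q i ≠ ⊤ := fun h => i.2 (Submodule.comap_subtype_eq_top.1 h)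
  have hcard : ((Finset.univ : Finset {i // ¬ W ≤ p i}).card : ℕ∞) < ENat.card F := by
    refine lt_of_le_of_lt ?_ hF
    rw [Finset.card_univ, Nat.card_eq_fintype_card]
    exact_mod_cast Fintype.card_subtype_le _
  obtain ⟨x, -, hx⟩ := Set.exists_of_ssubset
    (Submodule.iUnion_ssubset_of_forall_ne_top_of_card_lt Finset.univ q hq hcard)
  simp only [Finset.mem_univ, Set.iUnion_true, Set.mem_iUnion, not_exists] at hx
  exact ⟨x, x.2, fun i hi => by_contra fun hle => hx ⟨i, hle⟩ hi⟩

/-- A family of vectors `K d ∈ W d` is generic if each `K d` avoids every span of earlier vectors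
that it is not forced into by lying in `W d`. -/
structure IsGeneric [Preorder D] (W : D → Submodule F M) (K : D → M) : Prop where
  mem : ∀ d, K d ∈ W d
  le_span : ∀ d, ∀ Y ⊆ Set.Iio d, K d ∈ Submodule.span F (K '' Y) → W d ≤ Submodule.span F (K '' Y)

theorem exists_isGeneric [Preorder D] [Finite D] (hF : (2 ^ Nat.card D : ℕ∞) < ENat.card F)
    (W : (D → M) → D → Submodule F M)
    (hW : ∀ d K K', Set.EqOn K K' (Set.Iio d) → W K d = W K' d) :
    ∃ K, IsGeneric (W K) K := by
  obtain ⟨K, hK⟩ := exists_forall_rel_of_eqOn_Iio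
    (R := fun d K x => x ∈ W K d ∧ ∀ Y ⊆ Set.Iio d, x ∈ Submodule.span F (K '' Y) →
      W K d ≤ Submodule.span F (K '' Y))
    (fun d K => by
      obtain ⟨x, hx, hle⟩ := exists_mem_forall_mem_imp_le (W K d)
        (fun Y : Set D => Submodule.span F (K '' Y)) (by
          have := Fintype.ofFinite D
          simpa [Nat.card_eq_fintype_card] using hF)
      exact ⟨x, hx, fun Y _ => hle Y⟩)
    (fun d K K' x hKK' ⟨hx, hle⟩ => by
      rw [hW d K K' hKK'] at hx hle
      exact ⟨hx, fun Y hY => (hKK'.mono hY).image_eq ▸ hle Y hY⟩)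
  exact ⟨K, fun d => (hK d).1, fun d => (hK d).2⟩

namespace IsGeneric

variable [LinearOrder D] {W : D → Submodule F M} {K : D → M}

theorem exists_le_span_of_sum_mem_span (hK : IsGeneric W K) {S : Finset D} {Y : Set D}
    (hYS : ∀ y ∈ Y, ∀ d ∈ S, y < d) {c : D → F} (hc : ∃ d ∈ S, c d ≠ 0)
    (hsum : ∑ d ∈ S, c d • K d ∈ Submodule.span F (K '' Y)) :
    ∃ d ∈ S, W d ≤ Submodule.span F (K '' (Y ∪ S)) := by
  classical
  obtain ⟨d, hd, hmax⟩ := (S.filter (c · ≠ 0)).exists_max_image id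
    (by simpa [Finset.Nonempty, Finset.mem_filter] using hc)
  obtain ⟨hdS, hcd⟩ := Finset.mem_filter.1 hd
  let Z : Set D := Y ∪ {a | a ∈ S ∧ a < d}
  have hrest : ∑ a ∈ S.erase d, c a • K a ∈ Submodule.span F (K '' Z) := by
    refine Submodule.sum_mem _ fun a ha => ?_
    obtain ⟨had, haS⟩ := Finset.mem_erase.1 ha
    rcases eq_or_ne (c a) 0 with hca | hca
    · simp [hca]
    · have hlt : a < d := (hmax a (Finset.mem_filter.2 ⟨haS, hca⟩)).lt_of_ne had
      exact Submodule.smul_mem _ _ (Submodule.subset_span ⟨a, .inr ⟨haS, hlt⟩, rfl⟩)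
  have hKd : K d ∈ Submodule.span F (K '' Z) := by
    have hsumZ := Submodule.span_mono (Set.image_mono (Set.subset_union_left : Y ⊆ Z)) hsum
    rwa [← Finset.add_sum_erase _ _ hdS, Submodule.add_mem_iff_left _ hrest,
      Submodule.smul_mem_iff _ hcd] at hsumZ
  have hZ : Z ⊆ Set.Iio d := Set.union_subset (fun y hy => hYS y hy d hdS) fun a ha => ha.2
  refine ⟨d, hdS, (hK.le_span d Z hZ hKd).trans (Submodule.span_mono (Set.image_mono ?_))⟩
  exact Set.union_subset_union_right Y fun a ha => ha.1

theorem linearIndepOn (hK : IsGeneric W K) (U : Submodule F M) :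
    LinearIndepOn F K {d | K d ∈ U ∧ ¬ W d ≤ U} := by
  rw [linearIndepOn_iff_linearIndepOn_finset]
  intro S hS
  rw [linearIndepOn_finset_iff]
  intro c hc
  by_contra! hne
  obtain ⟨d, hd, hle⟩ := hK.exists_le_span_of_sum_mem_span (Y := ∅) (by simp) hne (by simp [hc])
  refine (hS hd).2 (hle.trans (Submodule.span_le.2 ?_))
  rintro _ ⟨a, ha, rfl⟩
  exact (hS (by simpa using ha)).1

end IsGeneric

end GenericFamily

namespace Network

section Topology

variable {V E : Type*} {s : ℕ}

theorem exists_linearOrder_lt_of_head_eq_tail (N : Network V E s) :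
    ∃ _ : LinearOrder E, ∀ d e, N.head d = N.tail e → d < e := by
  refine exists_linearOrder_lt_of_irrefl_transGen fun e he => N.acyclic (N.tail e) ?_
  exact he.lift N.tail fun d _ hde => ⟨d, by simp, rfl, hde⟩

theorem separated_univ [Fintype E] (N : Network V E s) :
    N.separated Finset.univ = Set.univ := by
  refine Set.eq_univ_of_forall fun i hi => ?_
  obtain ⟨_, ⟨e, he, -⟩, -⟩ := Relation.TransGen.head'_iff.1 hi
  exact he (Finset.mem_univ e)

theorem univ_mem_cuts [Fintype E] (hs : 1 ≤ s) (N : Network V E s) : Finset.univ ∈ N.cuts :=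
  ⟨⟨0, hs⟩, N.separated_univ.ge (Set.mem_univ _)⟩

end Topology

section Encoders

variable {V E A : Type*} {s k n : ℕ}

/-- The edge functions of a `(k, n)` network code, without a decoder; see `NetworkCode.enc`. -/
abbrev Encoders (N : Network V E s) (A : Type*) (k n : ℕ) : Type _ :=
  ∀ e : E, ({i : Fin s // N.source i = N.tail e} → Fin k → A) →
    ({d : E // N.head d = N.tail e} → Fin n → A) → Fin n → A

/-- The messages `u` result from the source messages `x` if the edges in `T` may be corrupted
arbitrarily and all other edges are free of errors. -/
def FollowsOff (N : Network V E s) (enc : N.Encoders A k n) (T : Finset E)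
    (x : Fin s → Fin k → A) (u : E → Fin n → A) : Prop :=
  ∀ e, e ∉ T → u e = enc e (fun i => x i) (fun d => u d)

variable {N : Network V E s} {enc : N.Encoders A k n}

theorem exists_followsOff [AddZeroClass A] [Finite E] (enc : N.Encoders A k n) (T : Finset E)
    (x : Fin s → Fin k → A) (t : E → Fin n → A) :
    ∃ u, N.FollowsOff enc T x u ∧ ∀ e ∈ T, u e = t e := by
  classical
  let overwrite : NetworkCode N A Unit k n :=
    ⟨fun e x u => if e ∈ T then t e else enc e x u, fun _ _ => ()⟩
  obtain ⟨u, hu, -⟩ := overwrite.existsUnique_isTransmission x 0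
  refine ⟨u, fun e he => (hu e).trans ?_, fun e he => (hu e).trans ?_⟩ <;> simp [overwrite, he]

section Agreement

variable {T T' C : Finset E} {x x' : Fin s → Fin k → A} {u u' : E → Fin n → A}

theorem FollowsOff.eqOn [Finite E] (hu : N.FollowsOff enc T x u) (hu' : N.FollowsOff enc T' x' u')
    {P : Set E} (hP : ∀ e ∈ P, u e = u' e ∨ e ∉ T ∧ e ∉ T' ∧
      (∀ i, N.source i = N.tail e → x i = x' i) ∧ ∀ d, N.head d = N.tail e → d ∈ P) :
    Set.EqOn u u' P := by
  obtain ⟨_, hlt⟩ := N.exists_linearOrder_lt_of_head_eq_tail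
  intro e he
  induction e using WellFoundedLT.induction with
  | ind e ih =>
    rcases hP e he with h | ⟨heT, heT', hx, hpred⟩
    · exact h
    rw [hu e heT, hu' e heT']
    congr 1
    · exact funext fun i => hx i i.2
    · exact funext fun d => ih d (hlt d e d.2) (hpred d d.2)

theorem FollowsOff.eq_of_forall_lt [Finite E] [LinearOrder E]
    (hlt : ∀ d e, N.head d = N.tail e → d < e) (hu : N.FollowsOff enc T x u)
    (hu' : N.FollowsOff enc T' x u') {e : E} (he : ∀ b ∈ T ∪ T', e < b) : u e = u' e := by
  refine hu.eqOn hu' (P := {a | ∀ b ∈ T ∪ T', a < b}) (fun a ha => .inr ⟨?_, ?_, ?_, ?_⟩) he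
  · exact fun haT => (ha a (Finset.mem_union_left _ haT)).false
  · exact fun haT' => (ha a (Finset.mem_union_right _ haT')).false
  · exact fun _ _ => rfl
  · exact fun d hd b hb => (hlt d a hd).trans (ha b hb)

theorem FollowsOff.eq_of_head_eq_sink [Finite E] (hu : N.FollowsOff enc T x u)
    (hu' : N.FollowsOff enc T' x' u') (hT : T ⊆ C) (hT' : T' ⊆ C) (hC : Set.EqOn u u' C)
    (hx : ∀ i ∉ N.separated C, x i = x' i) {e : E} (he : N.head e = N.sink) : u e = u' e := by
  refine hu.eqOn hu' (P := {a | N.head a = N.sink ∨ N.Reaches C (N.head a) N.sink})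
    (fun a ha => ?_) (.inl he)
  by_cases haC : a ∈ C
  · exact .inl (hC haC)
  have htail : N.Reaches C (N.tail a) N.sink := by
    rcases ha with ha | ha
    · exact .single ⟨a, haC, rfl, ha⟩
    · exact ha.head ⟨a, haC, rfl, rfl⟩
  refine .inr ⟨fun haT => haC (hT haT), fun haT' => haC (hT' haT'), fun i hi => ?_, fun d hd => ?_⟩
  · exact hx i (not_not.2 (hi ▸ htail))
  · exact .inr (hd ▸ htail)

end Agreement

end Encoders

end Network

namespace NetworkCode

variable {V E A O : Type*} {s k n τ : ℕ} {N : Network V E s} {f : (Fin s → A) → O}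

theorem computes_iff_followsOff [AddGroup A] (c : NetworkCode N A O k n) :
    c.Computes f τ ↔ ∀ (T : Finset E) (x : Fin s → Fin k → A) (u : E → Fin n → A), T.card ≤ τ →
      N.FollowsOff c.enc T x u → c.dec (fun e => u e) = fun j => f fun i => x i j := by
  constructor
  · intro hc T x u hT hu
    refine hc x T (fun e => -c.enc e (fun i => x i) (fun d => u d) + u e) u hT (fun e he => ?_)
      fun e => (add_neg_cancel_left _ _).symm
    rw [← hu e he, neg_add_cancel]
  · intro hc x T z u hT hz hu
    exact hc T x u hT fun e he => by rw [hu e, hz e he, add_zero]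

theorem exists_computes_of_forall_followsOff [AddGroup A] (enc : N.Encoders A k n)
    (h : ∀ (T T' : Finset E) (x x' : Fin s → Fin k → A) (u u' : E → Fin n → A),
      T.card ≤ τ → T'.card ≤ τ → N.FollowsOff enc T x u → N.FollowsOff enc T' x' u' →
        (∀ e, N.head e = N.sink → u e = u' e) →
          ∀ j, (f fun i => x i j) = f fun i => x' i j) :
    ∃ c : NetworkCode N A O k n, c.Computes f τ := by
  let Outcome : Type _ := {p : (Fin s → Fin k → A) × (E → Fin n → A) //
    ∃ T : Finset E, T.card ≤ τ ∧ N.FollowsOff enc T p.1 p.2}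
  let received (p : Outcome) (e : {e : E // N.head e = N.sink}) : Fin n → A := p.1.2 e
  let value (p : Outcome) (j : Fin k) : O := f fun i => p.1.1 i j
  have hfactors : value.FactorsThrough received := by
    rintro ⟨p, T, hT, hp⟩ ⟨p', T', hT', hp'⟩ heq
    exact funext (h T T' p.1 p'.1 p.2 p'.2 hT hT' hp hp' fun e he => congrFun heq ⟨e, he⟩)
  refine ⟨⟨enc, Function.extend received value fun _ _ => f 0⟩, ?_⟩
  rw [computes_iff_followsOff]
  intro T x u hT hu
  exact hfactors.extend_apply (fun _ _ => f 0) (⟨(x, u), T, hT, hu⟩ : Outcome)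

theorem Computes.eq_of_eqOn_of_forall_lt [AddGroup A] [Finite E] [LinearOrder E]
    (hlt : ∀ d e, N.head d = N.tail e → d < e) {c : NetworkCode N A O k n} (hc : c.Computes f τ)
    {C₁ C₂ C₃ : Finset E} (h₁₂ : ∀ a ∈ C₁, ∀ b ∈ C₂, a < b) (h₁₃ : ∀ a ∈ C₁, ∀ b ∈ C₃, a < b)
    (h₂₃ : ∀ a ∈ C₂, ∀ b ∈ C₃, a < b) (hC₂ : C₂.card ≤ τ) (hC₃ : C₃.card ≤ τ)
    {x x' : Fin s → Fin k → A} (hx : ∀ i ∉ N.separated (C₁ ∪ C₂ ∪ C₃), x i = x' i)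
    {u u' : E → Fin n → A} (hu : N.FollowsOff c.enc ∅ x u) (hu' : N.FollowsOff c.enc ∅ x' u')
    (h₁ : Set.EqOn u u' C₁) (j : Fin k) : (f fun i => x i j) = f fun i => x' i j := by
  rw [computes_iff_followsOff] at hc
  -- Errors on `C₂` make `x` look like `x'` there, and errors on `C₃` then make `x'` look like `x`.
  obtain ⟨v, hv, hv₂⟩ := N.exists_followsOff c.enc C₂ x u'
  obtain ⟨v', hv', hv₃⟩ := N.exists_followsOff c.enc C₃ x' v
  have hu'v' {e : E} (he : ∀ b ∈ C₃, e < b) : u' e = v' e :=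
    hu'.eq_of_forall_lt hlt hv' (by simpa using he)
  have hC : Set.EqOn v v' (C₁ ∪ C₂ ∪ C₃ : Finset E) := by
    intro e he
    simp only [Finset.coe_union, Set.mem_union, Finset.mem_coe] at he
    rcases he with (he₁ | he₂) | he₃
    · calc
        v e = u e := hv.eq_of_forall_lt hlt hu (by simpa using h₁₂ e he₁)
        _ = u' e := h₁ he₁
        _ = v' e := hu'v' (h₁₃ e he₁)
    · rw [hv₂ e he₂, hu'v' (h₂₃ e he₂)]
    · exact (hv₃ e he₃).symm
  have hsink : (fun e : {e : E // N.head e = N.sink} => v e) =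
      fun e : {e : E // N.head e = N.sink} => v' e :=
    funext fun e => hv.eq_of_head_eq_sink hv'
      (Finset.subset_union_right.trans Finset.subset_union_left) Finset.subset_union_right hC hx e.2
  have hdec := hc C₂ x v hC₂ hv
  rw [hsink, hc C₃ x' v' hC₃ hv'] at hdec
  exact (congrFun hdec j).symm

theorem Computes.le_mul_card_sub [AddGroup A] [Finite A] [Nontrivial A] [Finite E]
    {c : NetworkCode N A O k n} (hc : c.Computes f τ) {C : Finset E} {i₀ : Fin s}
    (hi₀ : i₀ ∈ N.separated C) (a : Fin s → A)
    (hf : Function.Injective fun y => f (Function.update a i₀ y)) :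
    k ≤ n * (C.card - 2 * τ) := by
  by_contra! hk_lt
  have := Fintype.ofFinite A
  obtain ⟨_, hlt⟩ := N.exists_linearOrder_lt_of_head_eq_tail
  obtain ⟨C₁, hC₁, hcard₁, h₁⟩ := exists_subset_card_eq_forall_lt C (Nat.sub_le C.card (2 * τ))
  have hcard := Finset.card_sdiff_of_subset hC₁
  obtain ⟨C₂, hC₂, hcard₂, h₂⟩ := exists_subset_card_eq_forall_lt (C \ C₁)
    (Nat.sub_le (C \ C₁).card τ)
  have hcard' := Finset.card_sdiff_of_subset hC₂
  have hC : C₁ ∪ C₂ ∪ ((C \ C₁) \ C₂) = C := by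
    rw [Finset.union_assoc, Finset.union_sdiff_of_subset hC₂, Finset.union_sdiff_of_subset hC₁]
  let x (y : Fin k → A) (i : Fin s) (j : Fin k) : A := Function.update a i₀ (y j) i
  choose u hu using fun y => N.exists_followsOff c.enc ∅ (x y) 0
  obtain ⟨y, y', hne, heq⟩ := Fintype.exists_ne_map_eq_of_card_lt
    (fun (y : Fin k → A) (e : C₁) => u y e) (by
      simp only [Fintype.card_fun, Fintype.card_fin, Fintype.card_coe, hcard₁, ← pow_mul]
      exact Nat.pow_lt_pow_right Fintype.one_lt_card hk_lt)
  refine hne (funext fun j => hf ?_)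
  refine hc.eq_of_eqOn_of_forall_lt hlt (fun a ha b hb => h₁ a ha b (hC₂ hb))
    (fun a ha b hb => h₁ a ha b (Finset.sdiff_subset hb)) h₂ (by omega) (by omega)
    (x := x y) (x' := x y') (fun i hi => ?_) (hu y).1 (hu y').1
    (fun e he => congrFun heq ⟨e, he⟩) j
  have hii₀ : i ≠ i₀ := by
    rintro rfl
    exact hi (hC.symm ▸ hi₀)
  simp [x, hii₀]

end NetworkCode

namespace Network

section GenericCoding

variable {V E B F M : Type*} {s : ℕ} {N : Network V E s} [Field F] [AddCommGroup M] [Module F M]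

/-- The vectors available at the node `v` for the coding vectors `K` of the edges: the span of the
vectors of the edges leaving `v`, and everything if `v` is the sink, where no constraint applies. -/
def outSpan (N : Network V E s) (F : Type*) [Field F] [Module F M] (K : E → M) (v : V) :
    Submodule F M :=
  (⨆ _ : v = N.sink, ⊤) ⊔ Submodule.span F (K '' {d | N.tail d = v})

theorem outSpan_sink (K : E → M) : N.outSpan F K N.sink = ⊤ := by
  simp [outSpan]

theorem outSpan_of_ne_sink (K : E → M) {v : V} (hv : v ≠ N.sink) :
    N.outSpan F K v = Submodule.span F (K '' {d | N.tail d = v}) := by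
  simp [outSpan, hv]

theorem mem_outSpan_tail (K : E → M) (e : E) : K e ∈ N.outSpan F K (N.tail e) :=
  Submodule.mem_sup_right (Submodule.subset_span ⟨e, rfl, rfl⟩)

theorem outSpan_congr {K K' : E → M} {v : V} (h : Set.EqOn K K' {d | N.tail d = v}) :
    N.outSpan F K v = N.outSpan F K' v := by
  rw [outSpan, outSpan, h.image_eq]

/-- The edges which leave the region of those nodes all of whose available vectors lie in `U`. -/
noncomputable def spanCut [Finite E] (N : Network V E s) (K : E → M) (U : Submodule F M) :
    Finset E :=
  (Set.toFinite {e | K e ∈ U ∧ ¬ N.outSpan F K (N.head e) ≤ U}).toFinset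

theorem mem_separated_spanCut [Finite E] {K : E → M} {U : Submodule F M} (hU : U ≠ ⊤) {i : Fin s}
    (hi : N.outSpan F K (N.source i) ≤ U) : i ∈ N.separated (N.spanCut K U) := by
  have hstep {v w : V} (hv : N.outSpan F K v ≤ U)
      (hvw : ∃ e, e ∉ N.spanCut K U ∧ N.tail e = v ∧ N.head e = w) : N.outSpan F K w ≤ U := by
    obtain ⟨e, he, rfl, rfl⟩ := hvw
    by_contra hle
    exact he ((Set.Finite.mem_toFinset _).2 ⟨hv (mem_outSpan_tail K e), hle⟩)
  have hreach {v : V} (hv : N.Reaches (N.spanCut K U) (N.source i) v) : N.outSpan F K v ≤ U := by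
    induction hv with
    | single h => exact hstep hi h
    | tail _ h ih => exact hstep ih h
  exact fun hsink => hU (top_le_iff.1 ((outSpan_sink K).ge.trans (hreach hsink)))

/-- Coding vectors `K e` of the edges, and vectors `g b` injected at the nodes `h b`, which are
combinations of the available vectors and satisfy only the linear relations forced by this:
`exists_outSpan_le` is about relations among the `g b` modulo the vectors of the edges in `ρ`, and
`linearIndepOn` about vectors that lie in `U` although not all vectors available to them do. -/
structure IsGenericCoding [Fintype B] (N : Network V E s) (F : Type*) [Field F] [Module F M]
    (h : B → V) (K : E → M) (g : B → M) : Prop where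
  mem_outSpan_head : ∀ e, K e ∈ N.outSpan F K (N.head e)
  mem_outSpan : ∀ b, g b ∈ N.outSpan F K (h b)
  exists_outSpan_le : ∀ (ρ : Set E) (c : B → F), c ≠ 0 →
    ∑ b, c b • g b ∈ Submodule.span F (K '' ρ) →
      ∃ b, N.outSpan F K (h b) ≤ Submodule.span F (Set.range g) ⊔ Submodule.span F (K '' ρ)
  linearIndepOn : ∀ U : Submodule F M, LinearIndepOn F (Sum.elim K g)
    {d | Sum.elim K g d ∈ U ∧ ¬ N.outSpan F K (Sum.elim N.head h d) ≤ U}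

theorem exists_linearOrder_sum (N : Network V E s) (B : Type*) :
    ∃ _ : LinearOrder (E ⊕ B), (∀ d e, N.head d = N.tail e → (.inl e : E ⊕ B) < .inl d) ∧
      ∀ e b, (.inl e : E ⊕ B) < .inr b := by
  obtain ⟨_, hlt⟩ := N.exists_linearOrder_lt_of_head_eq_tail
  obtain ⟨_, -⟩ := exists_wellFoundedLT B
  exact ⟨(inferInstance : LinearOrder (Eᵒᵈ ⊕ₗ B)),
    fun d e h => Sum.Lex.inl_lt_inl_iff (α := Eᵒᵈ).2 (hlt d e h),
    fun e b => Sum.Lex.inl_lt_inr (OrderDual.toDual e) b⟩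

theorem exists_isGenericCoding [Finite E] [Fintype B] (N : Network V E s) (h : B → V)
    (hF : (2 ^ (Nat.card E + Nat.card B) : ℕ∞) < ENat.card F) :
    ∃ (K : E → M) (g : B → M), N.IsGenericCoding F h K g := by
  -- The edges nearest the sink come first, so that the vectors available at a head are earlier.
  obtain ⟨_, hedge, hlt⟩ := N.exists_linearOrder_sum B
  let node : E ⊕ B → V := Sum.elim N.head h
  have hearlier : ∀ d e, N.tail e = node d → (.inl e : E ⊕ B) < d
    | .inl d, e, he => hedge d e he.symm
    | .inr b, e, _ => hlt e b
  obtain ⟨K, hK⟩ := exists_isGeneric (M := M) (by rwa [Nat.card_sum])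
    (fun K d => N.outSpan F (fun e => K (.inl e)) (node d))
    (fun d K K' hKK' => outSpan_congr fun e he => hKK' (hearlier d e he : .inl e < d))
  refine ⟨K ∘ .inl, K ∘ .inr, fun e => hK.mem (.inl e), fun b => hK.mem (.inr b), ?_, fun U => ?_⟩
  · intro ρ c hc hsum
    obtain ⟨d, hd, hle⟩ := hK.exists_le_span_of_sum_mem_span (S := Finset.univ.map .inr)
      (Y := Sum.inl '' ρ) (c := Sum.elim 0 c) (by simpa using fun e _ b => hlt e b)
      (by simpa [Function.ne_iff] using hc) (by simpa [Set.image_image] using hsum)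
    obtain ⟨b, -, rfl⟩ := Finset.mem_map.1 hd
    refine ⟨b, hle.trans_eq ?_⟩
    rw [Set.image_union, Submodule.span_union, sup_comm, Set.image_image]
    simp [Set.range_comp]
  · have hindep := hK.linearIndepOn U
    rwa [← Sum.elim_comp_inl_inr K] at hindep

theorem finrank_span_range_sup_span_lt [Fintype B] {K : E → M} {g : B → M} {ρ : Finset E}
    {c : B → F} (hc : c ≠ 0) (hsum : ∑ b, c b • g b ∈ Submodule.span F (K '' ρ)) :
    Module.finrank F ↥(Submodule.span F (Set.range g) ⊔ Submodule.span F (K '' ρ)) <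
      Fintype.card B + ρ.card := by
  by_contra! hcard
  have hspan : Set.range (Sum.elim g fun e : ρ => K e) = Set.range g ∪ K '' ρ := by
    rw [Set.Sum.elim_range, Set.image_eq_range]
    rfl
  have hindep : LinearIndependent F (Sum.elim g fun e : ρ => K e) := by
    rw [linearIndependent_iff_card_le_finrank_span, Set.finrank, hspan, Submodule.span_union]
    simpa using hcard
  obtain ⟨hg, -, hdisj⟩ := linearIndependent_sum.1 hindep
  refine hc (funext fun b => Fintype.linearIndependent_iff.1 hg c ?_ b)
  refine Submodule.disjoint_def.1 hdisj _ (Submodule.sum_mem _ fun b _ => ?_) ?_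
  · exact Submodule.smul_mem _ _ (Submodule.subset_span ⟨b, rfl⟩)
  · rwa [Set.image_eq_range] at hsum

namespace IsGenericCoding

variable [FiniteDimensional F M] [Fintype B] [Finite E] {h : B → V} {K : E → M} {g : B → M}

theorem card_spanCut_add_ncard_le (hKg : N.IsGenericCoding F h K g) (U : Submodule F M) :
    (N.spanCut K U).card + {b | g b ∈ U ∧ ¬ N.outSpan F K (h b) ≤ U}.ncard ≤
      Module.finrank F U := by
  let S := {d | Sum.elim K g d ∈ U ∧ ¬ N.outSpan F K (Sum.elim N.head h d) ≤ U}
  have hindep : LinearIndependent F fun d : S => (⟨Sum.elim K g d, d.2.1⟩ : U) :=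
    (hKg.linearIndepOn U).linearIndependent.of_comp U.subtype
  have hcard : Nat.card S = (N.spanCut K U).card +
      {b | g b ∈ U ∧ ¬ N.outSpan F K (h b) ≤ U}.ncard := by
    rw [Nat.card_congr (Equiv.subtypeSum (p := (· ∈ S))), Nat.card_sum, spanCut,
      ← Set.ncard_eq_toFinset_card]
    rfl
  have := Fintype.ofFinite S
  rw [← hcard, Nat.card_eq_fintype_card]
  exact hindep.fintype_card_le_finrank

theorem exists_card_spanCut_lt (hKg : N.IsGenericCoding F h K g) {ρ : Finset E}
    (hdim : Fintype.card B + ρ.card ≤ Module.finrank F M) {c : B → F} (hc : c ≠ 0)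
    (hsum : ∑ b, c b • g b ∈ Submodule.span F (K '' ρ)) :
    ∃ U : Submodule F M, U ≠ ⊤ ∧ (∃ b, N.outSpan F K (h b) ≤ U) ∧
      (N.spanCut K U).card < {b | N.outSpan F K (h b) ≤ U}.ncard + ρ.card := by
  have hfinrank := finrank_span_range_sup_span_lt hc hsum
  set U := Submodule.span F (Set.range g) ⊔ Submodule.span F (K '' ρ)
  have hgU (b : B) : g b ∈ U := Submodule.mem_sup_left (Submodule.subset_span ⟨b, rfl⟩)
  refine ⟨U, ?_, hKg.exists_outSpan_le ρ c hc hsum, ?_⟩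
  · intro hU
    rw [hU, finrank_top] at hfinrank
    exact hfinrank.not_ge hdim
  · have hle := hKg.card_spanCut_add_ncard_le U
    have hcompl := Set.ncard_add_ncard_compl {b | N.outSpan F K (h b) ≤ U}
    rw [Nat.card_eq_fintype_card] at hcompl
    simp only [hgU, true_and, ← Set.compl_ofPred] at hle
    omega

end IsGenericCoding

end GenericCoding

end Network

namespace Network

section LinearEncoders

variable {V E F M : Type*} {s k l τ : ℕ} {N : Network V E s} [Field F]

open scoped Classical in
/-- The edge functions of a scalar linear code: `A e d` is the coefficient of the message on `e` in
the message on `d`, and `b i j d` that of the `j`-th message of source `i`. Only the coefficients of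
messages available at the tail of `d` matter. -/
noncomputable def linearEncoders [Fintype E] (N : Network V E s) (A : E → E → F)
    (b : Fin s → Fin k → E → F) : N.Encoders F k 1 :=
  fun d x u _ => ∑ e : {e : E // N.head e = N.tail d}, u e 0 * A e d +
    ∑ i : {i : Fin s // N.source i = N.tail d}, ∑ j, x i j * b i j d

theorem FollowsOff.apply_eq_of_linearEncoders [Fintype E] {A : E → E → F}
    {b : Fin s → Fin k → E → F} (hA : ∀ e d, N.tail d ≠ N.head e → A e d = 0)
    (hb : ∀ i j d, N.tail d ≠ N.source i → b i j d = 0) {T : Finset E} {x : Fin s → Fin k → F}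
    {u : E → Fin 1 → F} (hu : N.FollowsOff (N.linearEncoders A b) T x u) {d : E} (hd : d ∉ T) :
    u d 0 = ∑ e, u e 0 * A e d + ∑ i, ∑ j, x i j * b i j d := by
  classical
  rw [hu d hd, linearEncoders]
  congr 1
  · refine Fintype.sum_of_injective _ Subtype.val_injective _ _ (fun e he => ?_) fun _ => rfl
    rw [hA e d fun h => he ⟨⟨e, h.symm⟩, rfl⟩, mul_zero]
  · refine Fintype.sum_of_injective _ Subtype.val_injective _ _ (fun i hi => ?_) fun _ => rfl
    refine Finset.sum_eq_zero fun j _ => ?_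
    rw [hb i j d fun h => hi ⟨⟨i, h.symm⟩, rfl⟩, mul_zero]

variable [AddCommGroup M] [Module F M]

theorem exists_sum_smul_eq_of_mem_outSpan [Fintype E] {K : E → M} {v : V} (hv : v ≠ N.sink) {y : M}
    (hy : y ∈ N.outSpan F K v) :
    ∃ a : E → F, (∀ d, N.tail d ≠ v → a d = 0) ∧ ∑ d, a d • K d = y := by
  rw [outSpan_of_ne_sink K hv, Finsupp.mem_span_image_iff_linearCombination] at hy
  obtain ⟨a, ha, rfl⟩ := hy
  exact ⟨a, (Finsupp.mem_supported' F a).1 ha,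
    (a.sum_fintype (fun d c => c • K d) fun d => zero_smul F (K d)).symm⟩

theorem FollowsOff.sum_sink_sub_mem_span [Fintype E] [DecidableEq V] {A : E → E → F}
    {b : Fin s → Fin k → E → F} (hA : ∀ e d, N.tail d ≠ N.head e → A e d = 0)
    (hb : ∀ i j d, N.tail d ≠ N.source i → b i j d = 0) {K : E → M} {g : Fin s → Fin k → M}
    (hAK : ∀ e, ∑ d, A e d • K d = if N.head e = N.sink then 0 else K e)
    (hbK : ∀ i j, ∑ d, b i j d • K d = g i j) {T : Finset E} {x : Fin s → Fin k → F}
    {u : E → Fin 1 → F} (hu : N.FollowsOff (N.linearEncoders A b) T x u) :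
    ∑ e : {e : E // N.head e = N.sink}, u e 0 • K e - ∑ i, ∑ j, x i j • g i j ∈
      Submodule.span F (K '' T) := by
  have herror : ∑ d, (u d 0 - (∑ e, u e 0 * A e d + ∑ i, ∑ j, x i j * b i j d)) • K d ∈
      Submodule.span F (K '' T) := by
    refine Submodule.sum_mem _ fun d _ => ?_
    by_cases hd : d ∈ T
    · exact Submodule.smul_mem _ _ (Submodule.subset_span ⟨d, hd, rfl⟩)
    · rw [← hu.apply_eq_of_linearEncoders hA hb hd, sub_self, zero_smul]
      exact Submodule.zero_mem _
  have hedges : ∑ d, (∑ e, u e 0 * A e d) • K d =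
      ∑ e, u e 0 • (if N.head e = N.sink then 0 else K e) := by
    simp only [Finset.sum_smul, mul_smul, ← hAK, Finset.smul_sum]
    exact Finset.sum_comm
  have hsources : ∑ d, (∑ i, ∑ j, x i j * b i j d) • K d = ∑ i, ∑ j, x i j • g i j := by
    simp only [Finset.sum_smul, mul_smul, ← hbK, Finset.smul_sum]
    rw [Finset.sum_comm]
    exact Finset.sum_congr rfl fun i _ => Finset.sum_comm
  have hsink : ∑ e : {e : E // N.head e = N.sink}, u e 0 • K e =
      ∑ e, u e 0 • K e - ∑ e, u e 0 • (if N.head e = N.sink then 0 else K e) := by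
    rw [← Finset.sum_sub_distrib]
    refine Fintype.sum_of_injective _ Subtype.val_injective _ _ (fun e he => ?_) fun e => ?_
    · simp [show N.head e ≠ N.sink from fun h => he ⟨⟨e, h⟩, rfl⟩]
    · simp [e.2]
  rw [hsink, sub_sub, ← hedges, ← hsources, ← Finset.sum_add_distrib, ← Finset.sum_sub_distrib]
  simpa only [sub_smul, add_smul] using herror

theorem exists_encoders_sum_sink_sub_mem_span [Fintype E] [DecidableEq V] {K : E → M}
    (hK : ∀ e, K e ∈ N.outSpan F K (N.head e)) {g : Fin s → Fin k → M}
    (hg : ∀ i j, g i j ∈ N.outSpan F K (N.source i)) :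
    ∃ enc : N.Encoders F k 1, ∀ (T : Finset E) (x : Fin s → Fin k → F) (u : E → Fin 1 → F),
      N.FollowsOff enc T x u → ∑ e : {e : E // N.head e = N.sink}, u e 0 • K e -
        ∑ i, ∑ j, x i j • g i j ∈ Submodule.span F (K '' T) := by
  have hrow (e : E) : ∃ a : E → F, (∀ d, N.tail d ≠ N.head e → a d = 0) ∧
      ∑ d, a d • K d = if N.head e = N.sink then 0 else K e := by
    split_ifs with he
    · exact ⟨0, by simp⟩
    · exact exists_sum_smul_eq_of_mem_outSpan he (hK e)
  choose A hA hAK using hrow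
  choose b hb hbK using fun i j =>
    exists_sum_smul_eq_of_mem_outSpan (N.source_ne_sink i) (hg i j)
  exact ⟨N.linearEncoders A b, fun T x u hu => hu.sum_sink_sub_mem_span hA hb hAK hbK⟩

theorem exists_computes_linearTarget [Finite E] {K : E → M}
    (hK : ∀ e, K e ∈ N.outSpan F K (N.head e)) {g : Fin s → Fin k → M}
    (hg : ∀ i j, g i j ∈ N.outSpan F K (N.source i)) (T : Matrix (Fin s) (Fin l) F)
    (h : ∀ (ρ : Finset E) (x : Fin s → Fin k → F), ρ.card ≤ 2 * τ →
      ∑ i, ∑ j, x i j • g i j ∈ Submodule.span F (K '' ρ) →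
        ∀ j, linearTarget T (fun i => x i j) = 0) :
    ∃ c : NetworkCode N F (Fin l → F) k 1, c.Computes (linearTarget T) τ := by
  classical
  have := Fintype.ofFinite E
  obtain ⟨enc, henc⟩ := exists_encoders_sum_sink_sub_mem_span hK hg
  refine NetworkCode.exists_computes_of_forall_followsOff enc
    fun ρ ρ' x x' u u' hρ hρ' hu hu' hsink j => ?_
  have hreceived : ∑ e : {e : E // N.head e = N.sink}, u e 0 • K e =
      ∑ e : {e : E // N.head e = N.sink}, u' e 0 • K e :=
    Fintype.sum_congr _ _ fun e => by rw [hsink e e.2]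
  have hmem := Submodule.sub_mem_sup (henc ρ' x' u' hu') (henc ρ x u hu)
  rw [hreceived, sub_sub_sub_cancel_left, ← Submodule.span_union, ← Set.image_union,
    ← Finset.coe_union] at hmem
  have hzero := h (ρ' ∪ ρ) (x - x') ((Finset.card_union_le _ _).trans (by omega))
    (by simpa only [Pi.sub_apply, sub_smul, Finset.sum_sub_distrib] using hmem) j
  rw [← sub_eq_zero, ← hzero]
  exact (Matrix.sub_vecMul T (fun i => x i j) fun i => x' i j).symm

end LinearEncoders

end Network

namespace Network

section Achievability

variable {V E F : Type*} {s k r l τ : ℕ} [Field F] [Finite E]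

theorem exists_computes_linearTarget_of_mul_add_le (N : Network V E s)
    (T : Matrix (Fin s) (Fin l) F) (hcut : ∀ C ∈ N.cuts, k * l + 2 * τ ≤ C.card)
    (hF : (2 ^ (Nat.card E + k * l) : ℕ∞) < ENat.card F) :
    ∃ c : NetworkCode N F (Fin l → F) k 1, c.Computes (linearTarget T) τ := by
  obtain ⟨K, g, hKg⟩ := N.exists_isGenericCoding (M := Fin (k * l + 2 * τ) → F)
    (fun _ : Fin k × Fin l => N.sink) (by simpa using hF)
  have hsource (i : Fin s) : N.outSpan F K (N.source i) = ⊤ := by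
    by_contra hne
    have hC := hcut _ ⟨i, mem_separated_spanCut hne le_rfl⟩
    have hfinrank := Submodule.finrank_lt hne
    have hle := hKg.card_spanCut_add_ncard_le (N.outSpan F K (N.source i))
    rw [Module.finrank_fin_fun] at hfinrank
    omega
  refine exists_computes_linearTarget hKg.mem_outSpan_head
    (g := fun i j => ∑ m, T i m • g (j, m)) (fun i j => hsource i ▸ Submodule.mem_top) T
    fun ρ x hρ hmem => ?_
  by_contra! hne
  obtain ⟨j, hj⟩ := hne
  let value (b : Fin k × Fin l) : F := linearTarget T (fun i => x i b.1) b.2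
  have hvalue : value ≠ 0 := fun h => hj (funext fun m => congrFun h (j, m))
  have hsum : ∑ i, ∑ j, x i j • ∑ m, T i m • g (j, m) = ∑ b, value b • g b := by
    simp only [value, linearTarget, Matrix.vecMul, dotProduct, Finset.sum_smul, Finset.smul_sum,
      mul_smul, Fintype.sum_prod_type]
    rw [Finset.sum_comm]
    exact Finset.sum_congr rfl fun j _ => Finset.sum_comm
  obtain ⟨U, hU, ⟨-, hsink⟩, -⟩ := hKg.exists_card_spanCut_lt (ρ := ρ) (by simpa using hρ) hvalue
    (hsum ▸ hmem)
  exact hU (top_le_iff.1 ((outSpan_sink K).ge.trans hsink))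

theorem exists_computes_linearTarget_one_of_mul_ncard_add_le (N : Network V E s)
    (hcut : ∀ C ∈ N.cuts, r * (N.separated C).ncard + 2 * τ ≤ C.card)
    (hF : (2 ^ (Nat.card E + s * r) : ℕ∞) < ENat.card F) :
    ∃ c : NetworkCode N F (Fin s → F) r 1,
      c.Computes (linearTarget (1 : Matrix (Fin s) (Fin s) F)) τ := by
  obtain ⟨K, g, hKg⟩ := N.exists_isGenericCoding (M := Fin (s * r + 2 * τ) → F)
    (fun b : Fin s × Fin r => N.source b.1) (by simpa using hF)
  refine exists_computes_linearTarget hKg.mem_outSpan_head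
    (fun i j => hKg.mem_outSpan (i, j)) 1 fun ρ x hρ hmem j => ?_
  suffices hx : x.uncurry = 0 by
    rw [linearTarget, Matrix.vecMul_one]
    exact funext fun i => congrFun hx (i, j)
  by_contra hx
  rw [← Fintype.sum_prod_type'] at hmem
  obtain ⟨U, hU, ⟨b, hb⟩, hlt⟩ := hKg.exists_card_spanCut_lt (by simpa using hρ) hx hmem
  have hC := hcut _ ⟨b.1, mem_separated_spanCut hU hb⟩
  have hprod : {b : Fin s × Fin r | N.outSpan F K (N.source b.1) ≤ U} =
      {i | N.outSpan F K (N.source i) ≤ U} ×ˢ Set.univ := by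
    ext
    simp
  have hncard : {i | N.outSpan F K (N.source i) ≤ U}.ncard ≤
      (N.separated (N.spanCut K U)).ncard :=
    Set.ncard_le_ncard (fun i hi => mem_separated_spanCut hU hi)
  rw [hprod, Set.ncard_prod, Set.ncard_univ, Nat.card_fin] at hlt
  have := Nat.mul_le_mul_right r hncard
  rw [mul_comm r (N.separated _).ncard] at hC
  omega

end Achievability

section Capacity

variable {V E A O : Type*} {s τ : ℕ}

theorem robustCapacity_le_iInf_cuts [AddGroup A] [Finite A] [Nontrivial A] [Finite E]
    (N : Network V E s) {f : (Fin s → A) → O}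
    (hf : ∀ i, ∃ a, Function.Injective fun y => f (Function.update a i y)) :
    robustCapacity N f τ ≤ ⨅ C ∈ N.cuts, ((C.card - 2 * τ : ℕ) : ℝ≥0∞) := by
  refine le_iInf₂ fun C ⟨i, hi⟩ => sSup_le ?_
  rintro _ ⟨k, n, -, -, ⟨c, hc⟩, rfl⟩
  obtain ⟨a, ha⟩ := hf i
  exact ENNReal.div_le_of_le_mul' (by exact_mod_cast hc.le_mul_card_sub hi a ha)

theorem iInf_cuts_le_robustCapacity [AddZeroClass A] {N : Network V E s} (hN : N.cuts.Nonempty)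
    {f : (Fin s → A) → O} {a : Finset E → ℕ}
    (h : ∀ k, 0 < k → (∀ C ∈ N.cuts, k ≤ a C) → ∃ c : NetworkCode N A O k 1, c.Computes f τ) :
    ⨅ C ∈ N.cuts, (a C : ℝ≥0∞) ≤ robustCapacity N f τ := by
  obtain ⟨C₀, hC₀, hmin⟩ := exists_minimalFor_of_wellFoundedLT (· ∈ N.cuts) a hN
  refine (iInf₂_le C₀ hC₀).trans ?_
  rcases (a C₀).eq_zero_or_pos with hzero | hpos
  · simp [hzero]
  · have hle : ∀ C ∈ N.cuts, a C₀ ≤ a C := fun C hC => (le_total _ _).elim id (hmin hC)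
    exact le_sSup ⟨a C₀, 1, hpos, one_pos, h _ hpos hle, by simp⟩

end Capacity

end Network

theorem injective_linearTarget_update {F : Type*} [Field F] {s l : ℕ}
    {T : Matrix (Fin s) (Fin l) F} {i : Fin s} (hT : T i ≠ 0) :
    Function.Injective fun y => linearTarget T (Function.update 0 i y) := by
  have hsmul (y : F) : linearTarget T (Function.update 0 i y) = y • T i :=
    Matrix.single_vecMul T i y
  simpa only [hsmul] using smul_left_injective F hT

theorem mul_add_le_of_le_floor_div {r a b m : ℕ} (hr : 0 < r) (hm : 0 < m)
    (h : r ≤ ⌊((a : ℝ) - b) / m⌋₊) : r * m + b ≤ a := by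
  rw [Nat.le_floor_iff' hr.ne', le_div_iff₀ (by exact_mod_cast hm), le_sub_iff_add_le] at h
  exact_mod_cast h

theorem two_pow_add_lt_card_of_four_pow_lt {α : Type*} [Finite α] {n m : ℕ} (hm : m ≤ n)
    (h : 4 ^ n < Nat.card α) : (2 ^ (n + m) : ℕ∞) < ENat.card α := by
  have hpow : 2 ^ (n + m) ≤ 4 ^ n := by
    rw [show 4 = 2 ^ 2 from rfl, ← pow_mul]
    exact Nat.pow_le_pow_right two_pos (by omega)
  rw [ENat.card_eq_coe_natCard]
  exact_mod_cast hpow.trans_lt h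

theorem mainTheorem3_general {V E F : Type*} [Finite E] [Field F] [Finite F] {s : ℕ} (hs : 1 ≤ s)
    (N : Network V E s) (τ : ℕ) (hF : 4 ^ Nat.card E < Nat.card F) :
    (robustCapacity N (linearTarget (Matrix.of fun _ _ => 1 : Matrix (Fin s) (Fin 1) F)) τ =
        (⨅ C ∈ N.cuts, ((C.card - 2 * τ : ℕ) : ℝ≥0∞))) ∧
      ((⨅ C ∈ N.cuts, ((⌊((C.card : ℝ) - 2 * τ) / (N.separated C).ncard⌋₊ : ℕ) : ℝ≥0∞)) ≤
        robustCapacity N (linearTarget (1 : Matrix (Fin s) (Fin s) F)) τ) := by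
  have := Fintype.ofFinite E
  have huniv := N.univ_mem_cuts hs
  have hlarge {m : ℕ} (hm : m + 2 * τ ≤ (Finset.univ : Finset E).card) :
      (2 ^ (Nat.card E + m) : ℕ∞) < ENat.card F := by
    rw [Finset.card_univ, ← Nat.card_eq_fintype_card] at hm
    exact two_pow_add_lt_card_of_four_pow_lt (by omega) hF
  refine ⟨le_antisymm ?_ ?_, ?_⟩
  · exact N.robustCapacity_le_iInf_cuts fun i =>
      ⟨0, injective_linearTarget_update fun h => one_ne_zero (congrFun h 0)⟩
  · refine Network.iInf_cuts_le_robustCapacity ⟨_, huniv⟩ fun k hk hle => ?_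
    have hcut : ∀ C ∈ N.cuts, k * 1 + 2 * τ ≤ C.card := fun C hC => by
      have := hle C hC
      omega
    exact N.exists_computes_linearTarget_of_mul_add_le _ hcut (hlarge (hcut _ huniv))
  · refine Network.iInf_cuts_le_robustCapacity ⟨_, huniv⟩ fun r hr hle => ?_
    have hcut : ∀ C ∈ N.cuts, r * (N.separated C).ncard + 2 * τ ≤ C.card := fun C hC =>
      mul_add_le_of_le_floor_div hr ((Set.ncard_pos).2 hC) (by exact_mod_cast hle C hC)
    refine N.exists_computes_linearTarget_one_of_mul_ncard_add_le hcut (hlarge ?_)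
    simpa [N.separated_univ, mul_comm] using hcut _ huniv

theorem mainTheorem3 {V E : Type*} [Finite V] [Finite E] {s : ℕ} (hs : 1 ≤ s)
    (N : Network V E s) (τ : ℕ) (hτ : 1 ≤ τ) (hcut : ∀ C ∈ N.cuts, 2 * τ < C.card) :
    ∃ q₀ : ℕ, ∀ (F : Type*) [Field F] [Finite F], q₀ ≤ Nat.card F →
      (robustCapacity N (linearTarget (Matrix.of fun _ _ => 1 : Matrix (Fin s) (Fin 1) F)) τ =
          (⨅ C ∈ N.cuts, ((C.card - 2 * τ : ℕ) : ℝ≥0∞))) ∧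
        ((⨅ C ∈ N.cuts, ((⌊((C.card : ℝ) - 2 * τ) / (N.separated C).ncard⌋₊ : ℕ) : ℝ≥0∞)) ≤
          robustCapacity N (linearTarget (1 : Matrix (Fin s) (Fin s) F)) τ) :=
  ⟨4 ^ Nat.card E + 1, fun _ _ _ hF => mainTheorem3_general hs N τ hF⟩
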